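/- Let $F$ be a finite field with $q=|F|$ elements and let $\alpha$ be a positive integer. For a positive integer $n$, a quasi-cyclic code of index $1\frac1\alpha$ over $F$ is an $F[X]$-submodule $C$ of $$\bigl(F[X]/\langle X^{n}-1\rangle\bigr)\times\bigl(F[X]/\langle X^{\alpha n}-1\rangle\bigr).$$ Identifying residue classes with their coefficient vectors, $C$ is regarded as a code of length $N=n+\alpha n$, that is, as a subset of $F^{N}$. For a code $C\subseteq F^N$, its rate is $\mathrm R(C)=\frac{\log_q|C|}{N}$ and its relative minimum distance is $\Delta(C)=\frac{\mathrm d(C)}{N}$, where $\mathrm d(C)$ is the minimum Hamming distance between distinct codewords. Then the quasi-cyclic codes of index $1\frac1\alpha$ over $F$ are asymptotically good: there are a real number $\delta>0$ and a sequence $C_1,C_2,\dots$ of quasi-cyclic codes of index $1\frac1\alpha$ over $F$ whose lengths go to infinity, such that $\mathrm R(C_i)\ge\delta$ and $\Delta(C_i)\ge\delta$ for all $i$. -/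

import Mathlib

open Polynomial Filter

/-- A block code over the alphabet `F`: a length `N` together with a set of words in `F ^ N`. -/
abbrev BlockCode (F : Type*) : Type _ := Σ N : ℕ, Set (Fin N → F)

namespace BlockCode

variable {F : Type*}

/-- The length `N` of a code `C ⊆ F ^ N`. -/
def length (C : BlockCode F) : ℕ := C.1

/-- The set of codewords of a code. -/
def words (C : BlockCode F) : Set (Fin C.length → F) := C.2

/-- The minimum Hamming distance between two distinct codewords
(by convention `0` for a code with at most one codeword). -/
noncomputable def minDist [DecidableEq F] (C : BlockCode F) : ℕ :=
  sInf {d : ℕ | ∃ x ∈ C.words, ∃ y ∈ C.words, x ≠ y ∧ hammingDist x y = d}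

/-- The relative minimum distance `Δ(C) = d(C) / N`. -/
noncomputable def relMinDist [DecidableEq F] (C : BlockCode F) : ℝ :=
  (C.minDist : ℝ) / (C.length : ℝ)

/-- The rate `R(C) = log_q |C| / N`, where `q = |F|`. -/
noncomputable def rate [Fintype F] (C : BlockCode F) : ℝ :=
  Real.logb (Fintype.card F : ℝ) (C.words.ncard : ℝ) / (C.length : ℝ)

/-- A sequence of codes is asymptotically good if the lengths go to infinity and both the rates
and the relative minimum distances are bounded below by one positive constant. -/
def IsAsymptoticallyGood [Fintype F] [DecidableEq F] (C : ℕ → BlockCode F) : Prop :=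
  Tendsto (fun i => (C i).length) atTop atTop ∧
    ∃ δ : ℝ, 0 < δ ∧ ∀ i, δ ≤ (C i).rate ∧ δ ≤ (C i).relMinDist

/-- A class of codes is asymptotically good if it contains an asymptotically good sequence. -/
def IsAsymptoticallyGoodClass [Fintype F] [DecidableEq F] (𝒞 : Set (BlockCode F)) : Prop :=
  ∃ C : ℕ → BlockCode F, (∀ i, C i ∈ 𝒞) ∧ IsAsymptoticallyGood C

end BlockCode

/-- The quotient ring `F[X] / ⟨X ^ m - 1⟩`, in particular an `F[X]`-module. -/
abbrev CyclicQuotient (F : Type*) [Field F] (m : ℕ) : Type _ :=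
  F[X] ⧸ Ideal.span ({X ^ m - 1} : Set F[X])

/-- The usual identification of words with residue classes: the word `(c₀, …, c_{m-1})`
corresponds to the class of `c₀ + c₁ X + ⋯ + c_{m-1} X ^ (m - 1)`; for `m > 0` every class comes
from exactly one word. -/
noncomputable def wordClass {F : Type*} [Field F] {m : ℕ} (c : Fin m → F) : CyclicQuotient F m :=
  Ideal.Quotient.mk (Ideal.span ({X ^ m - 1} : Set F[X])) (∑ i : Fin m, C (c i) * X ^ (i : ℕ))

/-- A double cyclic code of cycle length `(m', m)`: an `F[X]`-submodule of
`F[X] / ⟨X ^ m' - 1⟩ × F[X] / ⟨X ^ m - 1⟩`. -/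
abbrev DoubleCyclicCode (F : Type*) [Field F] (m' m : ℕ) : Type _ :=
  Submodule F[X] (CyclicQuotient F m' × CyclicQuotient F m)

/-- The block code of length `m' + m` of a double cyclic code: the words
`(c'₀, …, c'_{m'-1}, c₀, …, c_{m-1})` whose two blocks represent an element of the code. -/
noncomputable def DoubleCyclicCode.toBlockCode {F : Type*} [Field F] {m' m : ℕ}
    (D : DoubleCyclicCode F m' m) : BlockCode F :=
  ⟨m' + m, {c | (wordClass (fun i : Fin m' => c (Fin.castAdd m i)),
    wordClass (fun j : Fin m => c (Fin.natAdd m' j))) ∈ D}⟩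

/-- The class of quasi-cyclic codes of index `1 + 1/α` over `F`: the double cyclic codes of cycle
length `(n, α n)` with `n > 0` arbitrary. -/
def quasiCyclicCodes (F : Type*) [Field F] (α : ℕ) : Set (BlockCode F) :=
  {B | ∃ n : ℕ, 0 < n ∧ ∃ D : DoubleCyclicCode F n (α * n), B = D.toBlockCode}

/-! ### Words as residues modulo `X ^ n - 1`. -/

section ResidueWord

variable {F : Type*} [Field F]

/-! Take `n = K * m` with `m = p ^ k`, where the prime `p` and `K` depend only on `F`, chosen so
that every irreducible factor of the cyclotomic polynomial `Φ` of order `n` has degree at least `m`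
(`exists_degree_lower_bound_cyclotomic`). With `G = (X ^ n - 1) / Φ`, the code is generated by `G`
in the first block and by `G * b`, repeated `α` times, in the second. The multipliers `u` of degree
`< m` give distinct words, so the rate is bounded below (`card_pow_le_ncard_words`). For the
distance, `b` is found by counting (`exists_multiplier`): a bad `b` of degree `< m` yields a pair of
low-weight words that determines it, and there are fewer such pairs than candidates
(`card_hammingBall_sq_lt`). As `m / n = 1 / K` is constant, both bounds are linear in the length. -/

/-- The coefficient vector of the residue of `f` modulo `X ^ n - 1`. -/
noncomputable def residueWord (n : ℕ) (f : F[X]) : Fin n → F :=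
  fun i => (f %ₘ (X ^ n - 1)).coeff i

theorem monic_X_pow_sub_one {n : ℕ} (hn : 0 < n) : (X ^ n - 1 : F[X]).Monic := by
  simpa using monic_X_pow_sub_C (1 : F) hn.ne'

theorem degree_X_pow_sub_one {n : ℕ} (hn : 0 < n) : (X ^ n - 1 : F[X]).degree = n := by
  simpa using degree_X_pow_sub_C hn (1 : F)

theorem degree_modByMonic_X_pow_sub_one_lt {n : ℕ} (hn : 0 < n) (f : F[X]) :
    (f %ₘ (X ^ n - 1)).degree < n := by
  rw [← degree_X_pow_sub_one (F := F) hn]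
  exact degree_modByMonic_lt _ (monic_X_pow_sub_one hn)

theorem eq_of_coeff_eq_of_degree_lt {n : ℕ} {f g : F[X]} (hf : f.degree < n) (hg : g.degree < n)
    (h : ∀ i : Fin n, f.coeff i = g.coeff i) : f = g := by
  ext i
  by_cases hi : i < n
  · exact h ⟨i, hi⟩
  · have hi : (n : WithBot ℕ) ≤ i := by exact_mod_cast not_lt.mp hi
    rw [coeff_eq_zero_of_degree_lt (hf.trans_le hi), coeff_eq_zero_of_degree_lt (hg.trans_le hi)]

theorem dvd_sub_of_residueWord_eq {n : ℕ} (hn : 0 < n) {f g : F[X]}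
    (h : residueWord n f = residueWord n g) : X ^ n - 1 ∣ f - g := by
  rw [← modByMonic_eq_zero_iff_dvd (monic_X_pow_sub_one hn), sub_modByMonic, sub_eq_zero]
  exact eq_of_coeff_eq_of_degree_lt (degree_modByMonic_X_pow_sub_one_lt hn f)
    (degree_modByMonic_X_pow_sub_one_lt hn g) (congrFun h)

theorem residueWord_eq_of_dvd_sub {n : ℕ} (hn : 0 < n) {f g : F[X]}
    (h : X ^ n - 1 ∣ f - g) : residueWord n f = residueWord n g := by
  rw [← modByMonic_eq_zero_iff_dvd (monic_X_pow_sub_one hn), sub_modByMonic, sub_eq_zero] at h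
  funext i
  rw [residueWord, residueWord, h]

theorem degree_wordPolynomial_lt {m : ℕ} (c : Fin m → F) :
    (∑ i : Fin m, C (c i) * X ^ (i : ℕ) : F[X]).degree < m :=
  degree_sum_fin_lt c

theorem coeff_wordPolynomial {m : ℕ} (c : Fin m → F) (j : Fin m) :
    (∑ i : Fin m, C (c i) * X ^ (i : ℕ) : F[X]).coeff j = c j := by
  simp only [finsetSum_coeff, coeff_C_mul_X_pow]
  rw [Finset.sum_eq_single j]
  · simp
  · intro i _ hij
    rw [if_neg]
    exact fun h => hij (Fin.ext h.symm)
  · simp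

theorem wordClass_eq_mk_iff {m : ℕ} (hm : 0 < m) (c : Fin m → F) (f : F[X]) :
    wordClass c = Ideal.Quotient.mk (Ideal.span ({X ^ m - 1} : Set F[X])) f ↔
      c = residueWord m f := by
  have hc : residueWord m (∑ i : Fin m, C (c i) * X ^ (i : ℕ)) = c := by
    funext j
    rw [residueWord, (modByMonic_eq_self_iff (monic_X_pow_sub_one hm)).mpr, coeff_wordPolynomial]
    rw [degree_X_pow_sub_one hm]
    exact degree_wordPolynomial_lt c
  rw [wordClass, Ideal.Quotient.mk_eq_mk_iff_sub_mem, Ideal.mem_span_singleton]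
  constructor
  · intro h
    rw [← residueWord_eq_of_dvd_sub hm h, hc]
  · intro h
    exact dvd_sub_of_residueWord_eq hm (hc.trans h)

end ResidueWord

/-! ### Repeating a block of length `n`. -/

section Repetition

variable {F : Type*} [Field F]

/-- The polynomial `1 + X ^ n + ⋯ + X ^ (n (α - 1))`; multiplication by it repeats a block of
length `n` exactly `α` times. -/
noncomputable def repetitionPolynomial (F : Type*) [Field F] (n α : ℕ) : F[X] :=
  ∑ i ∈ Finset.range α, (X ^ n) ^ i

theorem X_pow_sub_one_mul_repetitionPolynomial (n α : ℕ) :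
    (X ^ n - 1) * repetitionPolynomial F n α = X ^ (α * n) - 1 := by
  rw [repetitionPolynomial, mul_geom_sum, ← pow_mul, mul_comm n]

theorem residueWord_mul_repetitionPolynomial {n α : ℕ} (hn : 0 < n) (hα : 0 < α) (f : F[X])
    (i : Fin n) (hi : (i : ℕ) < α * n) :
    residueWord (α * n) (f * repetitionPolynomial F n α) ⟨i, hi⟩ = residueWord n f i := by
  have hαn : 0 < α * n := Nat.mul_pos hα hn
  have hT : repetitionPolynomial F n α ≠ 0 := by
    intro h
    have := X_pow_sub_one_mul_repetitionPolynomial (F := F) n α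
    rw [h, mul_zero] at this
    exact (monic_X_pow_sub_one hαn).ne_zero this.symm
  have hdvd : X ^ (α * n) - 1 ∣
      f * repetitionPolynomial F n α - (f %ₘ (X ^ n - 1)) * repetitionPolynomial F n α := by
    rw [← sub_mul, ← X_pow_sub_one_mul_repetitionPolynomial]
    refine mul_dvd_mul_right ?_ _
    exact ⟨f /ₘ (X ^ n - 1), by linear_combination - modByMonic_add_div f (X ^ n - 1)⟩
  have hdeg : ((f %ₘ (X ^ n - 1)) * repetitionPolynomial F n α).degree < (α * n : ℕ) := by
    rw [← degree_X_pow_sub_one (F := F) hαn, ← X_pow_sub_one_mul_repetitionPolynomial,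
      degree_mul, degree_mul]
    refine WithBot.add_lt_add_right (by simpa using hT) ?_
    exact degree_modByMonic_lt _ (monic_X_pow_sub_one hn)
  rw [residueWord_eq_of_dvd_sub hαn hdvd, residueWord,
    (modByMonic_eq_self_iff (monic_X_pow_sub_one hαn)).mpr
      (by rwa [degree_X_pow_sub_one hαn]), residueWord]
  -- All terms of the repetition polynomial but the constant `1` are divisible by `X ^ n`, so they
  -- do not affect coefficients below `n`.
  obtain ⟨β, rfl⟩ := Nat.exists_eq_succ_of_ne_zero hα.ne'
  rw [repetitionPolynomial, Finset.sum_range_succ', pow_zero, mul_add, mul_one, coeff_add]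
  simp only [pow_succ, ← Finset.sum_mul, ← mul_assoc]
  rw [coeff_mul_X_pow', if_neg (by simp), zero_add]

/-- The first of the `α` copies suffices; losing the factor `α` is harmless. -/
theorem hammingNorm_residueWord_le [DecidableEq F] {n α : ℕ} (hn : 0 < n) (hα : 0 < α)
    (f : F[X]) : hammingNorm (residueWord n f) ≤
      hammingNorm (residueWord (α * n) (f * repetitionPolynomial F n α)) := by
  have hle : n ≤ α * n := Nat.le_mul_of_pos_left n hα
  refine Finset.card_le_card_of_injOn (Fin.castLE hle) ?_ (Fin.castLE_injective hle).injOn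
  intro i hi
  simp only [Finset.coe_filter, Finset.mem_univ, true_and, Set.mem_ofPred_eq] at hi ⊢
  rwa [← residueWord_mul_repetitionPolynomial hn hα f i (i.2.trans_le hle)] at hi

end Repetition

/-! ### Hamming balls and the choice of the multiplier. -/

section Counting

variable {F : Type*} [Field F] [Fintype F] [DecidableEq F]

/-- The words of length `n` and Hamming weight at most `w`. -/
noncomputable def hammingBall (F : Type*) [Field F] [Fintype F] [DecidableEq F] (n : ℕ) (w : ℝ) :
    Finset (Fin n → F) :=
  Finset.univ.filter fun z => (hammingNorm z : ℝ) ≤ w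

theorem mem_hammingBall {n : ℕ} {w : ℝ} {z : Fin n → F} :
    z ∈ hammingBall F n w ↔ (hammingNorm z : ℝ) ≤ w := by
  simp [hammingBall]

/-- Chernoff argument: each `z` in the ball has `s ^ (w - wt z) ≥ 1`, and the sum of `s ^ (-wt z)`
over all words factors over coordinates into at most `(1 + q / s) ^ n`. -/
theorem card_hammingBall_le (n : ℕ) {s : ℝ} (hs : 1 ≤ s) (w : ℝ) :
    ((hammingBall F n w).card : ℝ) ≤
      Real.exp (w * Real.log s + n * (Fintype.card F / s)) := by
  have hs0 : 0 < s := by linarith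
  have hsum : ∑ z : Fin n → F, (s⁻¹) ^ hammingNorm z ≤ Real.exp (n * (Fintype.card F / s)) := by
    have h1 : ∀ z : Fin n → F, (s⁻¹) ^ hammingNorm z = ∏ i, if z i ≠ 0 then s⁻¹ else 1 := by
      intro z
      rw [Finset.prod_ite, Finset.prod_const, Finset.prod_const_one, mul_one, hammingNorm]
    simp_rw [h1]
    have h2 := Finset.prod_univ_sum (fun _ : Fin n => (Finset.univ : Finset F))
      (fun _ a => if a ≠ 0 then s⁻¹ else (1 : ℝ))
    rw [Fintype.piFinset_univ] at h2
    rw [← h2, Finset.prod_const, Finset.card_univ, Fintype.card_fin, Real.exp_nat_mul]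
    have h3 : ∑ a : F, (if a ≠ 0 then s⁻¹ else (1 : ℝ)) ≤ Fintype.card F / s + 1 := by
      calc ∑ a : F, (if a ≠ 0 then s⁻¹ else (1 : ℝ))
          ≤ ∑ a : F, (s⁻¹ + if a = 0 then 1 else 0) := by
            refine Finset.sum_le_sum fun a _ => ?_
            by_cases ha : a = 0 <;> simp [ha, hs0.le]
        _ = Fintype.card F / s + 1 := by
            simp [Finset.sum_add_distrib, div_eq_mul_inv]
    refine pow_le_pow_left₀ (Finset.sum_nonneg fun a _ => ?_) (h3.trans (Real.add_one_le_exp _)) n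
    split_ifs <;> positivity
  rw [Real.exp_add, mul_comm w, Real.exp_mul, Real.exp_log hs0]
  calc ((hammingBall F n w).card : ℝ)
      = ∑ z ∈ hammingBall F n w, (1 : ℝ) := by simp
    _ ≤ ∑ z ∈ hammingBall F n w,
          s ^ w * (s⁻¹) ^ hammingNorm z := by
        refine Finset.sum_le_sum fun z hz => ?_
        rw [inv_pow, ← div_eq_mul_inv, le_div_iff₀ (by positivity), one_mul, ← Real.rpow_natCast]
        exact Real.rpow_le_rpow_of_exponent_le hs (mem_hammingBall.mp hz)
    _ ≤ ∑ z : Fin n → F, s ^ w * (s⁻¹) ^ hammingNorm z :=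
        Finset.sum_le_sum_of_subset_of_nonneg (Finset.subset_univ _)
          fun _ _ _ => by positivity
    _ ≤ s ^ w * Real.exp (n * (Fintype.card F / s)) := by
        rw [← Finset.mul_sum]
        exact mul_le_mul_of_nonneg_left hsum (by positivity)

omit [DecidableEq F] in
theorem natCard_degreeLT (m : ℕ) : Nat.card (degreeLT F m) = Fintype.card F ^ m := by
  rw [Nat.card_congr (degreeLTEquiv F m).toEquiv]
  simp

/-- If every `b` fails with some `u b`, the two light words determine `b` among degrees `< m`: equal
pairs for `b` and `b'` give `Φ ∣ (b - b') * u b`, and coprimality of `b - b'` with `Φ` forces `Φ ∣ u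
b`. -/
theorem exists_multiplier {n m : ℕ} (hn : 0 < n) {G Φ : F[X]} (hG : G * Φ = X ^ n - 1)
    (hΦ : ∀ c : F[X], c ≠ 0 → c.degree < m → IsCoprime c Φ) {w : ℝ}
    (hw : (hammingBall F n w).card ^ 2 <
      Fintype.card F ^ m) :
    ∃ b : F[X], ∀ u : F[X], ¬ Φ ∣ u → w < hammingNorm (residueWord n (u * G)) ∨
      w < hammingNorm (residueWord n (u * G * b)) := by
  by_contra! h
  choose u hu h1 h2 using h
  have hG0 : G ≠ 0 := by
    rintro rfl
    rw [zero_mul] at hG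
    exact (monic_X_pow_sub_one hn).ne_zero hG.symm
  let φ : degreeLT F m → hammingBall F n w × hammingBall F n w := fun b =>
    (⟨residueWord n (u b * G), mem_hammingBall.mpr (h1 b)⟩,
      ⟨residueWord n (u b * G * b), mem_hammingBall.mpr (h2 b)⟩)
  have hφ : Function.Injective φ := by
    intro b b' hbb'
    have e1 : residueWord n (u b * G) = residueWord n (u b' * G) :=
      congrArg (fun x => x.1.1) hbb'
    have e2 : residueWord n (u b * G * (b : F[X])) =
        residueWord n (u b' * G * (b' : F[X])) :=
      congrArg (fun x => x.2.1) hbb'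
    have d1 : Φ ∣ u b - u b' := by
      have := dvd_sub_of_residueWord_eq hn e1
      rw [← hG, show u b * G - u b' * G = G * (u b - u b') by ring] at this
      exact (mul_dvd_mul_iff_left hG0).mp this
    have d2 : Φ ∣ u b * (b : F[X]) - u b' * (b' : F[X]) := by
      have := dvd_sub_of_residueWord_eq hn e2
      rw [← hG, show u b * G * (b : F[X]) - u b' * G * (b' : F[X]) = G * (u b * b - u b' * b') by ring] at this
      exact (mul_dvd_mul_iff_left hG0).mp this
    by_contra hne
    have hne' : (b : F[X]) - b' ≠ 0 := fun h0 => hne (Subtype.ext (sub_eq_zero.mp h0))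
    have hcop := hΦ _ hne' (mem_degreeLT.mp (b - b').2)
    have d3 : Φ ∣ (b - b') * u b := by
      have := dvd_sub d2 (d1.mul_right (b' : F[X]))
      rwa [show u b * (b : F[X]) - u b' * (b' : F[X]) - (u b - u b') * b' = ((b : F[X]) - b') * u b by ring] at this
    exact hu b (hcop.symm.dvd_of_dvd_mul_left d3)
  have hcard := Nat.card_le_card_of_injective φ hφ
  rw [natCard_degreeLT, Nat.card_prod] at hcard
  simp only [Nat.card_eq_fintype_card, Fintype.card_coe] at hcard
  rw [pow_two] at hw
  omega

end Counting

/-! ### The code, its size and its distance. -/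

section Code

variable {F : Type*} [Field F]

/-- The quasi-cyclic code generated by the pair `(G, G b (1 + X ^ n + ⋯ + X ^ (n (α - 1))))`. -/
noncomputable def repetitionCode (n α : ℕ) (G b : F[X]) : DoubleCyclicCode F n (α * n) :=
  Submodule.span F[X] {(Ideal.Quotient.mk _ G,
    Ideal.Quotient.mk _ (G * b * repetitionPolynomial F n α))}

theorem mem_words_repetitionCode_iff {n α : ℕ} (hn : 0 < n) (hα : 0 < α) (G b : F[X])
    (c : Fin (n + α * n) → F) :
    c ∈ (repetitionCode n α G b).toBlockCode.words ↔ ∃ u : F[X],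
      c = Fin.append (residueWord n (u * G))
        (residueWord (α * n) (u * G * b * repetitionPolynomial F n α)) := by
  change (_, _) ∈ Submodule.span _ _ ↔ _
  rw [Submodule.mem_span_singleton]
  refine exists_congr fun u => ?_
  rw [Prod.smul_mk, Prod.mk.injEq, eq_comm]
  have h1 : u • (Ideal.Quotient.mk (Ideal.span ({X ^ n - 1} : Set F[X])) G) =
      Ideal.Quotient.mk _ (u * G) := rfl
  have h2 : u • (Ideal.Quotient.mk (Ideal.span ({X ^ (α * n) - 1} : Set F[X]))
      (G * b * repetitionPolynomial F n α)) =
      Ideal.Quotient.mk _ (u * G * b * repetitionPolynomial F n α) := by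
    rw [mul_assoc u, mul_assoc u]
    rfl
  rw [h1, h2, eq_comm (a := Ideal.Quotient.mk _ (u * G * b * repetitionPolynomial F n α)),
    wordClass_eq_mk_iff hn, wordClass_eq_mk_iff (Nat.mul_pos hα hn)]
  constructor
  · rintro ⟨e1, e2⟩
    rw [← e1, ← e2]
    exact (Fin.append_castAdd_natAdd).symm
  · rintro rfl
    constructor <;> funext i <;> simp

theorem hammingNorm_append [DecidableEq F] {m n : ℕ} (x : Fin m → F) (y : Fin n → F) :
    hammingNorm (Fin.append x y) = hammingNorm x + hammingNorm y := by
  simp only [hammingNorm, Finset.card_filter, Fin.sum_univ_add, Fin.append_left, Fin.append_right]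

variable [Fintype F]

theorem card_pow_le_ncard_words {n m α : ℕ} (hn : 0 < n) (hα : 0 < α) {G Φ : F[X]}
    (hG : G * Φ = X ^ n - 1) (hΦ : ∀ c : F[X], c ≠ 0 → c.degree < m → ¬ Φ ∣ c) (b : F[X]) :
    Fintype.card F ^ m ≤ (repetitionCode n α G b).toBlockCode.words.ncard := by
  have hG0 : G ≠ 0 := by
    rintro rfl
    rw [zero_mul] at hG
    exact (monic_X_pow_sub_one hn).ne_zero hG.symm
  let φ : degreeLT F m → (repetitionCode n α G b).toBlockCode.words := fun u =>
    ⟨_, (mem_words_repetitionCode_iff hn hα G b _).mpr ⟨u, rfl⟩⟩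
  have hφ : Function.Injective φ := by
    intro u u' h
    have h1 : residueWord n ((u : F[X]) * G) = residueWord n ((u' : F[X]) * G) := by
      funext i
      have := congrFun (congrArg Subtype.val h) (Fin.castAdd (α * n) i)
      simpa [φ] using this
    have h2 := dvd_sub_of_residueWord_eq hn h1
    rw [← hG, show (u : F[X]) * G - u' * G = G * (u - u') by ring,
      mul_dvd_mul_iff_left hG0] at h2
    by_contra hne
    exact hΦ _ (fun h0 => hne (Subtype.ext (sub_eq_zero.mp h0))) (mem_degreeLT.mp (u - u').2) h2
  -- Finiteness is essential: `ncard` of an infinite set is `0`.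
  have : Finite (repetitionCode n α G b).toBlockCode.words :=
    
    @Subtype.finite _ (inferInstanceAs (Finite (Fin (n + α * n) → F))) _
  have := Nat.card_le_card_of_injective φ hφ
  rwa [natCard_degreeLT] at this

omit [Fintype F] in
theorem lt_hammingDist_of_mem_words [DecidableEq F] {n α : ℕ} (hn : 0 < n) (hα : 0 < α)
    {G Φ b : F[X]} (hG : G * Φ = X ^ n - 1) {w : ℝ}
    (hb : ∀ u : F[X], ¬ Φ ∣ u → w < hammingNorm (residueWord n (u * G)) ∨
      w < hammingNorm (residueWord n (u * G * b)))
    {x y : Fin (n + α * n) → F} (hx : x ∈ (repetitionCode n α G b).toBlockCode.words)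
    (hy : y ∈ (repetitionCode n α G b).toBlockCode.words) (hxy : x ≠ y) :
    w < hammingDist x y := by
  have hz : x - y ∈ (repetitionCode n α G b).toBlockCode.words := by
    obtain ⟨u, rfl⟩ := (mem_words_repetitionCode_iff hn hα G b x).mp hx
    obtain ⟨v, rfl⟩ := (mem_words_repetitionCode_iff hn hα G b y).mp hy
    refine (mem_words_repetitionCode_iff hn hα G b _).mpr ⟨u - v, ?_⟩
    funext i
    refine Fin.addCases (fun i => ?_) (fun i => ?_) i <;>
      simp [residueWord, sub_modByMonic, sub_mul]
  obtain ⟨u, hu⟩ := (mem_words_repetitionCode_iff hn hα G b _).mp hz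
  -- If `Φ ∣ u`, both blocks vanish, so the difference word would be zero.
  have hΦu : ¬ Φ ∣ u := by
    rintro ⟨v, rfl⟩
    have hd : ∀ N (f : F[X]), 0 < N → X ^ N - 1 ∣ f → residueWord N f = 0 := by
      intro N f hN hf
      funext i
      rw [residueWord, (modByMonic_eq_zero_iff_dvd (monic_X_pow_sub_one hN)).mpr hf]
      simp
    rw [hd n _ hn ⟨v, by rw [← hG]; ring⟩, hd (α * n) _ (Nat.mul_pos hα hn) ⟨v * b, by
      rw [← X_pow_sub_one_mul_repetitionPolynomial, ← hG]; ring⟩] at hu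
    refine hxy (sub_eq_zero.mp (hu.trans ?_))
    funext i
    refine Fin.addCases (fun i => ?_) (fun i => ?_) i <;> simp
  rw [hammingDist_comm, hammingDist_eq_hammingNorm, neg_add_eq_sub, hu, hammingNorm_append, Nat.cast_add]
  have hrep : (hammingNorm (residueWord n (u * G * b)) : ℝ) ≤
      hammingNorm (residueWord (α * n) (u * G * b * repetitionPolynomial F n α)) := by
    exact_mod_cast hammingNorm_residueWord_le hn hα (u * G * b)
  have n1 := Nat.cast_nonneg (α := ℝ) (hammingNorm (residueWord n (u * G)))
  have n2 := Nat.cast_nonneg (α := ℝ)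
    (hammingNorm (residueWord (α * n) (u * G * b * repetitionPolynomial F n α)))
  rcases hb u hΦu with h | h <;> linarith

end Code

/-! ### Degrees of irreducible factors of cyclotomic polynomials. -/

section Cyclotomic

/-- Lifting the exponent, applied to `q ^ (p - 1)`, which is `1` modulo `p` by Fermat: the valuation
of `q ^ ((p - 1) * d) - 1` is `e` plus that of `d`, so `p ^ k ∣ d`. -/
theorem pow_le_of_pow_dvd_pow_sub_one {p q d e k : ℕ} (hp : p.Prime) (hp2 : Odd p)
    (hq : 1 < q) (hpq : p.Coprime q) (hd : 0 < d)
    (he : e = padicValNat p (q ^ (p - 1) - 1)) (h : p ^ (e + k) ∣ q ^ d - 1) : p ^ k ≤ d := by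
  have : Fact p.Prime := ⟨hp⟩
  have hp1 : p - 1 ≠ 0 := (Nat.sub_pos_of_lt hp.one_lt).ne'
  have hlt : 1 < q ^ (p - 1) := Nat.one_lt_pow hp1 hq
  have hfermat : p ∣ q ^ (p - 1) - 1 := by
    have := Nat.ModEq.pow_totient hpq.symm
    rw [Nat.totient_prime hp] at this
    exact (Nat.modEq_iff_dvd' hlt.le).mp this.symm
  have hndvd : ¬ p ∣ q ^ (p - 1) := fun hdvd =>
    (hp.coprime_iff_not_dvd.mp hpq) (hp.dvd_of_dvd_pow hdvd)
  have hval := padicValNat.pow_sub_pow (p := p) hp2 hlt hfermat hndvd hd.ne'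
  have hdvd : p ^ (e + k) ∣ (q ^ (p - 1)) ^ d - 1 ^ d := by
    rw [one_pow, ← pow_mul, mul_comm, pow_mul]
    refine h.trans ?_
    simpa using Nat.sub_dvd_pow_sub_pow (q ^ d) 1 (p - 1)
  have hne : (q ^ (p - 1)) ^ d - 1 ^ d ≠ 0 := by
    have := Nat.one_lt_pow hd.ne' hlt
    rw [one_pow]
    omega
  rw [padicValNat_dvd_iff_le hne, hval, ← he] at hdvd
  have hk : k ≤ padicValNat p d := by omega
  exact Nat.le_of_dvd hd ((padicValNat_dvd_iff_le hd.ne').mpr hk)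

/-- An irreducible factor has degree equal to the order of `q` modulo `p ^ (e + k)`; the constant
loss is `K = p ^ e`. -/
theorem exists_degree_lower_bound_cyclotomic (F : Type*) [Field F] [Fintype F] :
    ∃ p K : ℕ, p.Prime ∧ 0 < K ∧ ∀ k : ℕ, ∀ h : F[X], Irreducible h →
      h ∣ cyclotomic (K * p ^ k) F → p ^ k ≤ h.natDegree := by
  obtain ⟨r, f, hr, hf, hK⟩ : ∃ r f : ℕ, r.Prime ∧ 0 < f ∧ Fintype.card F = r ^ f := by
    obtain ⟨r, hr⟩ := CharP.exists F
    obtain ⟨f, hr', hK⟩ := FiniteField.card F r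
    exact ⟨r, f, hr', f.pos, hK⟩
  -- Taking `p > q` makes `p` both odd and prime to `q`.
  obtain ⟨p, hlt, hp⟩ := Nat.exists_infinite_primes (Fintype.card F + 1)
  have hq : 1 < Fintype.card F := Fintype.one_lt_card
  have hp2 : Odd p := hp.odd_of_ne_two (by omega)
  have hpq : p.Coprime (Fintype.card F) :=
    hp.coprime_iff_not_dvd.mpr fun h => absurd (Nat.le_of_dvd (by omega) h) (by omega)
  set e := padicValNat p (Fintype.card F ^ (p - 1) - 1) with he
  refine ⟨p, p ^ e, hp, pow_pos hp.pos e, fun k h hirr hdvd => ?_⟩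
  rw [← pow_add] at hdvd
  have : Fact r.Prime := ⟨hr⟩
  have hrp : r.Coprime (p ^ (e + k)) := by
    rw [hK] at hpq
    exact (Nat.Coprime.coprime_dvd_right (dvd_pow_self r hf.ne') hpq).symm.pow_right _
  have : NeZero (p ^ (e + k)) := ⟨(pow_pos hp.pos _).ne'⟩
  rw [natDegree_of_dvd_cyclotomic_of_irreducible hK hrp hdvd hirr]
  refine pow_le_of_pow_dvd_pow_sub_one hp hp2 hq hpq (orderOf_pos _) he ?_
  have h1 := congrArg Units.val
    (pow_orderOf_eq_one (ZMod.unitOfCoprime (r ^ f) (hrp.pow_left f)))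
  rw [Units.val_pow_eq_pow_val, ZMod.coe_unitOfCoprime, Units.val_one, ← Nat.cast_pow,
    ← Nat.cast_one, ZMod.natCast_eq_natCast_iff] at h1
  rw [hK]
  exact (Nat.modEq_iff_dvd' (Nat.one_le_pow _ _ (pow_pos hr.pos f))).mp h1.symm

end Cyclotomic

/-! ### Constants and the asymptotic bounds. -/

section Asymptotics

variable {F : Type*} [Field F]

theorem isCoprime_cyclotomic_of_degree_lt {n m : ℕ}
    (hm : ∀ h : F[X], Irreducible h → h ∣ cyclotomic n F → m ≤ h.natDegree)
    {c : F[X]} (hc : c ≠ 0) (hcm : c.degree < m) : IsCoprime c (cyclotomic n F) := by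
  refine isCoprime_of_irreducible_dvd (fun h => hc h.1) fun h hirr hd hdΦ => ?_
  have h1 := hm h hirr hdΦ
  have h2 := natDegree_le_of_dvd hd hc
  have h3 := (natDegree_lt_iff_degree_lt hc).mpr hcm
  omega

theorem not_cyclotomic_dvd_of_degree_lt {n m : ℕ} (hn : 0 < n)
    (hm : ∀ h : F[X], Irreducible h → h ∣ cyclotomic n F → m ≤ h.natDegree)
    {c : F[X]} (hc : c ≠ 0) (hcm : c.degree < m) : ¬ cyclotomic n F ∣ c := by
  intro hd
  have hu := (isCoprime_cyclotomic_of_degree_lt hm hc hcm).symm.isUnit_of_dvd' dvd_rfl hd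
  have h1 := natDegree_eq_zero_of_isUnit hu
  rw [natDegree_cyclotomic] at h1
  exact (Nat.totient_pos.mpr hn).ne' h1

variable [Fintype F] [DecidableEq F]

theorem card_hammingBall_sq_lt {K m : ℕ} (hK : 0 < K) (hm : 0 < m) {s : ℝ}
    (hs : s = 16 * K * Fintype.card F) :
    (hammingBall F (K * m) (m / (16 * Real.log s))).card ^ 2 < Fintype.card F ^ m := by
  have hq : (2 : ℝ) ≤ Fintype.card F := by exact_mod_cast Fintype.one_lt_card (α := F)
  have hK1 : (1 : ℝ) ≤ K := by exact_mod_cast hK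
  have hm1 : (1 : ℝ) ≤ m := by exact_mod_cast hm
  have hs1 : 1 < s := by rw [hs]; nlinarith
  have hlog : 0 < Real.log s := Real.log_pos hs1
  have h := card_hammingBall_le (F := F) (K * m) hs1.le (m / (16 * Real.log s))
  -- The choices of `w` and `s` make each summand `m / 16`; squaring the ball then gives `exp (m /
  -- 4) < 2 ^ m`.
  have hexp : m / (16 * Real.log s) * Real.log s + ((K * m : ℕ) : ℝ) * (Fintype.card F / s) =
      m / 8 := by
    rw [hs] at hlog ⊢
    have : (Fintype.card F : ℝ) ≠ 0 := by positivity
    push_cast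
    field_simp
    norm_num
  rw [hexp] at h
  have h2 : (2 : ℝ) * (m / 8) < m * Real.log (Fintype.card F) := by
    have := Real.log_two_gt_d9
    have := Real.log_le_log two_pos hq
    nlinarith
  have h3 := (pow_le_pow_left₀ (Nat.cast_nonneg _) h 2).trans_lt
    (show Real.exp (m / 8) ^ 2 < (Fintype.card F : ℝ) ^ m by
      rw [← Real.exp_nat_mul, ← Real.exp_log (show (0 : ℝ) < Fintype.card F by linarith),
        ← Real.exp_nat_mul]
      exact Real.exp_lt_exp.mpr (by exact_mod_cast h2))
  exact_mod_cast h3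

theorem exists_quasiCyclicCode {K m α : ℕ} (hK : 0 < K) (hm : 0 < m) (hα : 0 < α)
    (hdeg : ∀ h : F[X], Irreducible h → h ∣ cyclotomic (K * m) F → m ≤ h.natDegree) {s : ℝ}
    (hs : s = 16 * K * Fintype.card F) :
    ∃ C ∈ quasiCyclicCodes F α, C.length = K * m + α * (K * m) ∧
      1 / (K * (1 + α)) ≤ C.rate ∧ 1 / (16 * Real.log s) / (K * (1 + α)) ≤ C.relMinDist := by
  have hn : 0 < K * m := Nat.mul_pos hK hm
  obtain ⟨G, hG⟩ := cyclotomic.dvd_X_pow_sub_one (K * m) F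
  rw [mul_comm (cyclotomic _ F)] at hG
  have hball := card_hammingBall_sq_lt (F := F) hK hm hs
  obtain ⟨b, hb⟩ := exists_multiplier hn hG.symm
    (fun c hc hcm => isCoprime_cyclotomic_of_degree_lt hdeg hc hcm) hball
  have hcard := card_pow_le_ncard_words (α := α) hn hα hG.symm
    (fun c hc hcm => not_cyclotomic_dvd_of_degree_lt hn hdeg hc hcm) b
  have hlen : (repetitionCode (K * m) α G b).toBlockCode.length = K * m + α * (K * m) := rfl
  have hlenR : ((repetitionCode (K * m) α G b).toBlockCode.length : ℝ) = m * (K * (1 + α)) := by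
    rw [hlen]
    push_cast
    ring
  have hK0 : (0 : ℝ) < K := by exact_mod_cast hK
  have hm0 : (0 : ℝ) < m := by exact_mod_cast hm
  have hq : (1 : ℝ) < Fintype.card F := by exact_mod_cast Fintype.one_lt_card (α := F)
  refine ⟨_, ⟨K * m, hn, repetitionCode (K * m) α G b, rfl⟩, hlen, ?_, ?_⟩
  · rw [BlockCode.rate, hlenR, div_le_div_iff₀ (by positivity) (by positivity)]
    have h1 : (m : ℝ) ≤ Real.logb (Fintype.card F)
        ((repetitionCode (K * m) α G b).toBlockCode.words.ncard) := by
      rw [Real.le_logb_iff_rpow_le hq, Real.rpow_natCast]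
      · exact_mod_cast hcard
      · exact_mod_cast (pow_pos Fintype.card_pos m).trans_le hcard
    rw [one_mul]
    gcongr
  · rw [BlockCode.relMinDist, hlenR, ← div_div _ (m : ℝ),
      div_le_div_iff_of_pos_right (by positivity), le_div_iff₀ hm0]
    -- Two distinct codewords exist, so the infimum is attained and is not the default `0`.
    have h1 : 1 < (repetitionCode (K * m) α G b).toBlockCode.words.ncard :=
      (Nat.one_lt_pow hm.ne' Fintype.one_lt_card).trans_le hcard
    obtain ⟨x, hx, y, hy, hxy⟩ := (Set.one_lt_ncard_iff_nontrivial_and_finite.mp h1).1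
    have hne : {d : ℕ | ∃ x ∈ (repetitionCode (K * m) α G b).toBlockCode.words,
        ∃ y ∈ (repetitionCode (K * m) α G b).toBlockCode.words,
          x ≠ y ∧ hammingDist x y = d}.Nonempty := ⟨_, x, hx, y, hy, hxy, rfl⟩
    obtain ⟨x, hx, y, hy, hxy, hd⟩ := Nat.sInf_mem hne
    rw [BlockCode.minDist, ← hd, one_div_mul_eq_div]
    exact (lt_hammingDist_of_mem_words hn hα hG.symm hb hx hy hxy).le

end Asymptotics

theorem corollary1p4 (F : Type*) [Field F] [Fintype F] [DecidableEq F] (α : ℕ) (hα : 0 < α) :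
    BlockCode.IsAsymptoticallyGoodClass (quasiCyclicCodes F α) := by
  obtain ⟨p, K, hp, hK, hdeg⟩ := exists_degree_lower_bound_cyclotomic F
  set s : ℝ := 16 * K * Fintype.card F with hs
  choose C hC hlen hrate hdist using fun i : ℕ =>
    exists_quasiCyclicCode hK (pow_pos hp.pos i) hα (hdeg i) hs
  have hK1 : (1 : ℝ) ≤ K := by exact_mod_cast hK
  have hq : (1 : ℝ) ≤ Fintype.card F := by exact_mod_cast Fintype.card_pos (α := F)
  have hlog : 0 < Real.log s := Real.log_pos (by rw [hs]; nlinarith)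
  refine ⟨C, hC, ?_, min (1 / (K * (1 + α))) (1 / (16 * Real.log s) / (K * (1 + α))), ?_,
    fun i => ⟨(min_le_left _ _).trans (hrate i), (min_le_right _ _).trans (hdist i)⟩⟩
  · refine tendsto_atTop_mono (fun i => ?_) (tendsto_pow_atTop_atTop_of_one_lt hp.one_lt)
    rw [hlen]
    exact (Nat.le_mul_of_pos_left _ hK).trans (Nat.le_add_right _ _)
  · have : (0 : ℝ) < K := by linarith
    exact lt_min (by positivity) (by positivity)
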